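/- Let $T\ge 0$ and let $P$ and $\tilde P$ be discrete probability measures on path spaces $\Xi_0\times\dots\times\Xi_T$ and $\tilde\Xi_0\times\dots\times\tilde\Xi_T$ with finite supports $\Xi$ and $\tilde\Xi$ (finite scenario trees), such that all paths in $\Xi$ have the same initial value, and likewise for $\tilde\Xi$. Let $\mathcal F_t$ and $\tilde{\mathcal F}_t$ be the $\sigma$-algebras on $\Xi$ and $\tilde\Xi$ generated by the coordinates up to stage $t$. Let $d$ be a real-valued cost function (e.g. a distance) on pairs of paths, $r\ge 1$ and $\lambda>0$. For paths $i\in\Xi$, $j\in\tilde\Xi$ let $i_t$, $j_t$ be their histories up to stage $t$ (the predecessor nodes at stage $t$), and write $i\succ i_t$ if $i$ passes through the node $i_t$. Primal problem: minimize $\sum_{i,j}\bigl(\pi_{ij}\,d_{ij}^r+\tfrac1\lambda\,\pi_{ij}\log\pi_{ij}\bigr)$ over all $\pi\colon\Xi\times\tilde\Xi\to(0,\infty)$ with $\sum_{i,j}\pi_{ij}=1$ and, for all stages $t$ and all $i\in\Xi$, $j\in\tilde\Xi$, $$\sum_{j'\succ j_t}\pi(i,j'\mid i_t,j_t)=P(i\mid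 i_t),\qquad \sum_{i'\succ i_t}\pi(i',j\mid i_t,j_t)=\tilde P(j\mid j_t),\qquad\text{where } \pi(i,j\mid i_t,j_t)=\frac{\pi_{ij}}{\sum_{i'\succ i_t,\,j'\succ j_t}\pi_{i'j'}}.$$ Dual problem: maximize $M_0\in\mathbb R$ over all processes on $\Xi\times\tilde\Xi$ of the form $$M_t=M_0+\sum_{s=1}^t(\hat\beta_s+\hat\gamma_s),\qquad t=0,\dots,T,$$ where $\hat\beta_s$ is $\mathcal F_s\otimes\tilde{\mathcal F}_{s-1}$-measurable, $\hat\gamma_s$ is $\mathcal F_{s-1}\otimes\tilde{\mathcal F}_s$-measurable, $E_P[\hat\beta_s(\cdot,\tilde\xi)\mid\mathcal F_{s-1}]=0$ for every $\tilde\xi\in\tilde\Xi$ and $E_{\tilde P}[\hat\gamma_s(\xi,\cdot)\mid\tilde{\mathcal F}_{s-1}]=0$ for every $\xi\in\Xi$, and where $(\xi,\tilde\xi)\mapsto e^{-\lambda(d(\xi,\tilde\xi)^r-M_T(\xi,\tilde\xi))-1}$ is a probability mass function on $\Xi\times\tilde\Xi$. Then the primal problem has exactly one optimal solution $\pi$,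 and the supremum of the dual problem is attained. Every process $M$ attaining it satisfies $\pi=e^{-\lambda(d^r-M_T)-1}$, and $(M_t)_{t=0,\dots,T}$ is a martingale with respect to the optimal measure $\pi$ and the filtration $(\mathcal F_t\otimes\tilde{\mathcal F}_t)_{t=0,\dots,T}$. -/

import Mathlib

open MeasureTheory

noncomputable section

/-- A finite-valued stochastic process with stages `0, …, T` (a finite scenario tree): a discrete
probability measure on the path space `Ξ₀ × ⋯ × Ξ_T`, with finite support. All paths in the
support start in the same root. -/
structure ScenarioTree {T : ℕ} (Ξ : Fin (T + 1) → Type*) where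
  /-- The paths of positive probability. -/
  support : Finset (∀ t, Ξ t)
  /-- The probability of each path in the support. -/
  prob : support → ℝ
  prob_pos : ∀ ω, 0 < prob ω
  prob_sum : ∑ ω, prob ω = 1
  root : ∀ ω ω' : support, ω.1 0 = ω'.1 0

namespace ScenarioTree

variable {T : ℕ} {Ξ Ξ' : Fin (T + 1) → Type*}

/-- The finite set of scenarios (paths of positive probability, i.e. leaf nodes of the tree). -/
def Scenario (P : ScenarioTree Ξ) : Type _ := P.support

instance (P : ScenarioTree Ξ) : Fintype P.Scenario :=
  inferInstanceAs (Fintype P.support)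

instance (P : ScenarioTree Ξ) : MeasurableSpace P.Scenario := ⊤

instance (P : ScenarioTree Ξ) : DiscreteMeasurableSpace P.Scenario := ⟨fun _ => trivial⟩

/-- The path `(ξ₀, …, ξ_T)` belonging to a scenario. -/
def path (P : ScenarioTree Ξ) (ω : P.Scenario) : ∀ t, Ξ t := ω.1

/-- The probability of a scenario. -/
def p (P : ScenarioTree Ξ) (ω : P.Scenario) : ℝ := P.prob ω

/-- Two scenarios pass through the same node of stage `t`: their histories up to `t` agree. -/
def SameNode (P : ScenarioTree Ξ) (t : Fin (T + 1)) (ω ω' : P.Scenario) : Prop :=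
  ∀ s ≤ t, P.path ω s = P.path ω' s

open Classical in
/-- The conditional probability `P(i ∣ i_t)` of the leaf `i` given its predecessor at stage `t`. -/
def condProb (P : ScenarioTree Ξ) (t : Fin (T + 1)) (i : P.Scenario) : ℝ :=
  P.p i / ∑ i' with P.SameNode t i i', P.p i'

/-- The probability measure `P = ∑ᵢ pᵢ δ_{ξᵢ}` on the scenarios. -/
def measure (P : ScenarioTree Ξ) : Measure P.Scenario :=
  ∑ ω, ENNReal.ofReal (P.p ω) • Measure.dirac ω

/-- The filtration `F_t` generated by the coordinates up to stage `t`. -/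
def filtration (P : ScenarioTree Ξ) :
    Filtration (Fin (T + 1)) (inferInstance : MeasurableSpace P.Scenario) where
  seq t := ⨆ s ≤ t, MeasurableSpace.comap (fun ω => P.path ω s) ⊤
  mono' _ _ hst := biSup_mono fun _ h => h.trans hst
  le' _ := le_top

/-- The product filtration `F_t ⊗ F̃_t`. -/
def jointFiltration (P : ScenarioTree Ξ) (Q : ScenarioTree Ξ') :
    Filtration (Fin (T + 1)) (inferInstance : MeasurableSpace (P.Scenario × Q.Scenario)) where
  seq t := (P.filtration t).prod (Q.filtration t)
  mono' _ _ hst := sup_le_sup (MeasurableSpace.comap_mono (P.filtration.mono hst))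
    (MeasurableSpace.comap_mono (Q.filtration.mono hst))
  le' t := sup_le_sup (MeasurableSpace.comap_mono (P.filtration.le t))
    (MeasurableSpace.comap_mono (Q.filtration.le t))

/-! ### The primal problem -/

open Classical in
/-- The mass `∑_{i' ≻ i_t, j' ≻ j_t} π(i', j')` of the pair of nodes `(i_t, j_t)`, the predecessors
at stage `t` of the leaves `i` and `j`. -/
def nodeMass (P : ScenarioTree Ξ) (Q : ScenarioTree Ξ') (π : P.Scenario × Q.Scenario → ℝ)
    (t : Fin (T + 1)) (i : P.Scenario) (j : Q.Scenario) : ℝ :=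
  ∑ i' with P.SameNode t i i', ∑ j' with Q.SameNode t j j', π (i', j')

open Classical in
/-- Feasible transport plans of the (entropy-regularized) nested problem: strictly positive
probability mass functions `π` such that, for all stages `t`,
`∑_{j ≻ j_t} π(i, j ∣ i_t, j_t) = P(i ∣ i_t)` and `∑_{i ≻ i_t} π(i, j ∣ i_t, j_t) = P̃(j ∣ j_t)`,
where `π(i, j ∣ i_t, j_t) = π(i, j) / ∑_{i' ≻ i_t, j' ≻ j_t} π(i', j')`. -/
structure IsNestedPlan (P : ScenarioTree Ξ) (Q : ScenarioTree Ξ')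
    (π : P.Scenario × Q.Scenario → ℝ) : Prop where
  pos : ∀ x, 0 < π x
  sum_eq_one : ∑ x, π x = 1
  fst_cond : ∀ t i j,
    ∑ j' with Q.SameNode t j j', π (i, j') / nodeMass P Q π t i j' = P.condProb t i
  snd_cond : ∀ t i j,
    ∑ i' with P.SameNode t i i', π (i', j) / nodeMass P Q π t i' j = Q.condProb t j

/-- The cost `d(ξ, ξ̃)^r` of a pair of scenarios. -/
def cost (P : ScenarioTree Ξ) (Q : ScenarioTree Ξ') (d : (∀ t, Ξ t) → (∀ t, Ξ' t) → ℝ) (r : ℝ)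
    (x : P.Scenario × Q.Scenario) : ℝ :=
  d (P.path x.1) (Q.path x.2) ^ r

/-- The entropy-regularized objective `∑ π d^r + (1/λ) π log π`. -/
def entropicCost (P : ScenarioTree Ξ) (Q : ScenarioTree Ξ')
    (d : (∀ t, Ξ t) → (∀ t, Ξ' t) → ℝ) (r lam : ℝ) (π : P.Scenario × Q.Scenario → ℝ) : ℝ :=
  ∑ x, (π x * cost P Q d r x + 1 / lam * (π x * Real.log (π x)))

/-- `π` is an optimal transport plan of the entropy-regularized nested problem. -/
def IsOptimalPlan (P : ScenarioTree Ξ) (Q : ScenarioTree Ξ')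
    (d : (∀ t, Ξ t) → (∀ t, Ξ' t) → ℝ) (r lam : ℝ) (π : P.Scenario × Q.Scenario → ℝ) : Prop :=
  IsNestedPlan P Q π ∧
    ∀ ρ, IsNestedPlan P Q ρ → entropicCost P Q d r lam π ≤ entropicCost P Q d r lam ρ

/-- The measure on pairs of scenarios with probability mass function `π`. -/
def planMeasure (P : ScenarioTree Ξ) (Q : ScenarioTree Ξ') (π : P.Scenario × Q.Scenario → ℝ) :
    Measure (P.Scenario × Q.Scenario) :=
  ∑ x, ENNReal.ofReal (π x) • Measure.dirac x

/-! ### The dual problem -/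

/-- The projection `proj_t`: conditional expectation (under `P`) given `F_t` in the first
variable, the second variable being fixed. -/
def proj (P : ScenarioTree Ξ) (Q : ScenarioTree Ξ') (t : Fin (T + 1))
    (f : P.Scenario × Q.Scenario → ℝ) : P.Scenario × Q.Scenario → ℝ :=
  fun x => (P.measure[fun ω => f (ω, x.2) | P.filtration t]) x.1

/-- The projection `proj̃_t`: conditional expectation (under `P̃`) given `F̃_t` in the second
variable, the first variable being fixed. -/
def projTilde (P : ScenarioTree Ξ) (Q : ScenarioTree Ξ') (t : Fin (T + 1))
    (f : P.Scenario × Q.Scenario → ℝ) : P.Scenario × Q.Scenario → ℝ :=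
  fun x => (Q.measure[fun ω => f (x.1, ω) | Q.filtration t]) x.2

/-- The process `M` has the form `M_t = M₀ + ∑_{s=1}^t (β̂_s + γ̂_s)` with
`β̂_s` measurable for `F_s ⊗ F̃_{s-1}`, `γ̂_s` measurable for `F_{s-1} ⊗ F̃_s`,
`proj_{s-1} β̂_s = 0` and `proj̃_{s-1} γ̂_s = 0`. The increment with index `s : Fin T` is the one
from stage `s.castSucc` to stage `s.succ`. -/
def IsDualProcess (P : ScenarioTree Ξ) (Q : ScenarioTree Ξ') (M₀ : ℝ)
    (M : Fin (T + 1) → P.Scenario × Q.Scenario → ℝ) : Prop :=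
  ∃ β γ : Fin T → P.Scenario × Q.Scenario → ℝ,
    (∀ s, Measurable[(P.filtration s.succ).prod (Q.filtration s.castSucc)] (β s)) ∧
    (∀ s, Measurable[(P.filtration s.castSucc).prod (Q.filtration s.succ)] (γ s)) ∧
    (∀ s, proj P Q s.castSucc (β s) = 0) ∧
    (∀ s, projTilde P Q s.castSucc (γ s) = 0) ∧
    ∀ t x, M t x = M₀ + ∑ s with s.succ ≤ t, (β s x + γ s x)

/-- The mass function `exp(-λ (d^r - M_T) - 1)` on pairs of scenarios. -/
def gibbs (P : ScenarioTree Ξ) (Q : ScenarioTree Ξ') (d : (∀ t, Ξ t) → (∀ t, Ξ' t) → ℝ)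
    (r lam : ℝ) (M : Fin (T + 1) → P.Scenario × Q.Scenario → ℝ) (x : P.Scenario × Q.Scenario) : ℝ :=
  Real.exp (-lam * (cost P Q d r x - M (Fin.last T) x) - 1)

/-- Feasibility for the dual problem: `M` is of the above form, and `exp(-λ (d^r - M_T) - 1)` is a
probability mass function (it is positive anyway). -/
def IsDualFeasible (P : ScenarioTree Ξ) (Q : ScenarioTree Ξ')
    (d : (∀ t, Ξ t) → (∀ t, Ξ' t) → ℝ) (r lam M₀ : ℝ)
    (M : Fin (T + 1) → P.Scenario × Q.Scenario → ℝ) : Prop :=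
  IsDualProcess P Q M₀ M ∧ ∑ x, gibbs P Q d r lam M x = 1

/-- The supremum of all dual feasible numbers `M₀` is attained by the process `M`. -/
def IsDualOptimal (P : ScenarioTree Ξ) (Q : ScenarioTree Ξ')
    (d : (∀ t, Ξ t) → (∀ t, Ξ' t) → ℝ) (r lam M₀ : ℝ)
    (M : Fin (T + 1) → P.Scenario × Q.Scenario → ℝ) : Prop :=
  IsDualFeasible P Q d r lam M₀ M ∧
    IsLUB {m : ℝ | ∃ N, IsDualFeasible P Q d r lam m N} M₀

end ScenarioTree

end

/-!
All spaces are finite, so the theorem is a finite-dimensional convex duality statement. A function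
is `F_s ⊗ F̃_t`-measurable if and only if it is constant on pairs of nodes of stages `s` and `t`, and
conditional expectations vanish if and only if the weighted sums over nodes do
(`IsAtomRel.measurable_iff`, `IsAtomRel.condExp_eq_zero_iff`). Once the denominators are cleared, the
nested constraints are linear in `π` (`isNestedPlan_iff`).

Under a nested plan `π` the increments `β̂_s` and `γ̂_s` are martingale differences
(`IsIncrement.sum_node_eq_zero`). Hence every dual process is a `π`-martingale
(`IsDualProcess.martingale`), and `M₀` is the mean of `M_T` under `π`. As
`M_T = d^r + (log g + 1)/λ` with `g` the Gibbs mass function of `M`, Gibbs' inequality shows that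
`M₀` is at most the primal objective of `π` plus `1/λ`, with equality if and only if `π = g`
(`weak_duality`).

A primal minimizer exists by compactness; it is strictly positive because the entropy has slope `-∞`
at zero (`exists_isOptimalPlan`). Its gradient `d^r + (log π + 1)/λ` annihilates all feasible
directions. The functionals that define the constraints are themselves terminal values `M_T` of dual
processes (`constraint_mem_dualSpace`), so the gradient is such a terminal value, and its process
has Gibbs mass function `π` (`IsOptimalPlan.exists_dual`). This process attains equality in
`weak_duality`. The equality case then gives the uniqueness of the optimal plan and the Gibbs form
for every dual optimal process.
-/

/-! ### Measurability and conditional expectation on finite spaces -/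

namespace ScenarioTree

section Atoms

open scoped Classical

variable {α β : Type*}

/-- The relation `R` is an equivalence whose classes are the atoms of the `σ`-algebra `m`:
the classes are measurable, and every measurable set is a union of classes. -/
structure IsAtomRel (m : MeasurableSpace α) (R : α → α → Prop) : Prop where
  equiv : Equivalence R
  measurableSet_class : ∀ x, MeasurableSet[m] {y | R x y}
  mem_of_rel : ∀ s, MeasurableSet[m] s → ∀ x y, R x y → x ∈ s → y ∈ s

theorem IsAtomRel.measurable_iff [Countable α] {m : MeasurableSpace α} {R : α → α → Prop}
    (hR : IsAtomRel m R) {f : α → ℝ} :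
    Measurable[m] f ↔ ∀ x y, R x y → f x = f y := by
  constructor
  · intro hf x y hxy
    have := hR.mem_of_rel _ (hf (measurableSet_singleton (f x))) x y hxy rfl
    exact this.symm
  · intro hf s _
    have : f ⁻¹' s = ⋃ x ∈ f ⁻¹' s, {y | R x y} := by
      ext y
      simp only [Set.mem_iUnion, Set.mem_ofPred_eq, exists_prop]
      constructor
      · exact fun hy => ⟨y, hy, hR.equiv.refl y⟩
      · rintro ⟨x, hx, hxy⟩
        simpa [Set.mem_preimage, ← hf x y hxy] using hx
    rw [this]
    exact MeasurableSet.biUnion (Set.to_countable _) fun x _ => hR.measurableSet_class x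

theorem IsAtomRel.prod {m : MeasurableSpace α} {m' : MeasurableSpace β}
    {R : α → α → Prop} {R' : β → β → Prop} (hR : IsAtomRel m R) (hR' : IsAtomRel m' R') :
    IsAtomRel (m.prod m') fun x y => R x.1 y.1 ∧ R' x.2 y.2 where
  equiv := ⟨fun x => ⟨hR.equiv.refl _, hR'.equiv.refl _⟩,
    fun h => ⟨hR.equiv.symm h.1, hR'.equiv.symm h.2⟩,
    fun h h' => ⟨hR.equiv.trans h.1 h'.1, hR'.equiv.trans h.2 h'.2⟩⟩
  measurableSet_class x :=
    (hR.measurableSet_class x.1).prod (hR'.measurableSet_class x.2)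
  mem_of_rel := by
    rintro s hs ⟨a, b⟩ ⟨a', b'⟩ ⟨h, h'⟩ hx
    have h₁ : (a', b) ∈ s := hR.mem_of_rel {c | (c, b) ∈ s}
      (@measurable_prodMk_right _ _ m m' b s hs) a a' h hx
    exact hR'.mem_of_rel {c | (a', c) ∈ s}
      (@measurable_prodMk_left _ _ m m' a' s hs) b b' h' h₁

/-- A function with vanishing sums over the classes of `R` is orthogonal to every function that is
constant on the classes. -/
theorem sum_mul_eq_zero_of_class_sums [Fintype α] {R : α → α → Prop} (hR : Equivalence R)
    {g h : α → ℝ} (hg : ∀ x, ∑ y with R x y, g y = 0) (hh : ∀ x y, R x y → h x = h y) :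
    ∑ x, h x * g x = 0 := by
  let s : Setoid α := ⟨R, hR⟩
  rw [← Finset.sum_fiberwise Finset.univ (Quotient.mk s)]
  refine Finset.sum_eq_zero fun q _ => ?_
  induction q using Quotient.inductionOn with
  | h x =>
    have : (Finset.univ.filter fun y => Quotient.mk s y = Quotient.mk s x) =
        Finset.univ.filter fun y => R x y := by
      ext y
      simp only [Finset.mem_filter, Finset.mem_univ, true_and]
      rw [Quotient.eq]
      exact ⟨fun h => hR.symm h, fun h => hR.symm h⟩
    rw [this, Finset.sum_congr rfl fun y hy => by
      rw [← hh x y (Finset.mem_filter.1 hy).2], ← Finset.mul_sum, hg, mul_zero]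

variable [Fintype α] {m : MeasurableSpace α} [m₀ : MeasurableSpace α] [DiscreteMeasurableSpace α]

instance (w : α → ℝ) :
    IsFiniteMeasure (∑ x, ENNReal.ofReal (w x) • Measure.dirac x : Measure α) :=
  ⟨by simp⟩

theorem setIntegral_sum_dirac {w : α → ℝ} (hw : ∀ x, 0 ≤ w x) (f : α → ℝ) (s : Set α) :
    ∫ x in s, f x ∂(∑ x, ENNReal.ofReal (w x) • Measure.dirac x : Measure α) =
      ∑ x with x ∈ s, w x * f x := by
  rw [← integral_indicator (MeasurableSet.of_discrete), integral_finsetSum_measure]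
  · rw [Finset.sum_filter]
    refine Finset.sum_congr rfl fun x _ => ?_
    rw [integral_smul_measure, integral_dirac, ENNReal.toReal_ofReal (hw x), smul_eq_mul,
      Set.indicator_apply]
    split_ifs <;> simp
  · exact fun _ _ => (Integrable.of_finite).smul_measure ENNReal.ofReal_ne_top

theorem ae_sum_dirac {w : α → ℝ} (hw : ∀ x, 0 < w x) {p : α → Prop}
    (h : ∀ᵐ x ∂(∑ x, ENNReal.ofReal (w x) • Measure.dirac x : Measure α), p x) (x : α) : p x := by
  refine (ae_iff_of_countable.1 h) x ?_
  simp only [Measure.coe_finsetSum, Finset.sum_apply, Measure.smul_apply, smul_eq_mul, ne_eq,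
    Finset.sum_eq_zero_iff, Finset.mem_univ, true_implies, not_forall]
  exact ⟨x, by simpa using hw x⟩

/-- On a finite space the conditional expectation of `f` is the function that is constant on the
atoms and has the same weighted sums over the atoms as `f`. -/
theorem IsAtomRel.ae_eq_condExp {R : α → α → Prop} (hR : IsAtomRel m R)
    {w f g : α → ℝ} (hw : ∀ x, 0 ≤ w x) (hg : ∀ x y, R x y → g x = g y)
    (h : ∀ x, ∑ y with R x y, w y * (f y - g y) = 0) :
    (∑ x, ENNReal.ofReal (w x) • Measure.dirac x : Measure α)[f | m]
      =ᵐ[∑ x, ENNReal.ofReal (w x) • Measure.dirac x] g := by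
  have hm : m ≤ m₀ := fun s _ => MeasurableSet.of_discrete
  symm
  refine ae_eq_condExp_of_forall_setIntegral_eq hm Integrable.of_finite
    (fun _ _ _ => Integrable.of_finite) (fun s hs _ => ?_)
    ((hR.measurable_iff.2 hg).stronglyMeasurable.aestronglyMeasurable)
  rw [setIntegral_sum_dirac hw, setIntegral_sum_dirac hw, eq_comm, ← sub_eq_zero,
    ← Finset.sum_sub_distrib]
  have := sum_mul_eq_zero_of_class_sums hR.equiv h (h := fun x => if x ∈ s then 1 else 0)
    (fun x y hxy => by
      rw [if_congr ⟨hR.mem_of_rel s hs x y hxy, hR.mem_of_rel s hs y x (hR.equiv.symm hxy)⟩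
        rfl rfl])
  simpa [Finset.sum_filter, mul_sub] using this

/-- The conditional expectation vanishes if and only if all weighted sums over atoms do. -/
theorem IsAtomRel.condExp_eq_zero_iff {R : α → α → Prop}
    (hR : IsAtomRel m R) {w f : α → ℝ} (hw : ∀ x, 0 < w x) :
    (∀ x, ((∑ x, ENNReal.ofReal (w x) • Measure.dirac x : Measure α)[f | m]) x = 0) ↔
      ∀ x, ∑ y with R x y, w y * f y = 0 := by
  have hm : m ≤ m₀ := fun s _ => MeasurableSet.of_discrete
  constructor
  · intro h x
    have := setIntegral_condExp (μ := ∑ x, ENNReal.ofReal (w x) • Measure.dirac x) hm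
      (Integrable.of_finite (f := f)) (hR.measurableSet_class x)
    rw [setIntegral_sum_dirac fun x => (hw x).le, setIntegral_sum_dirac fun x => (hw x).le] at this
    simpa [h] using this.symm
  · intro h
    exact ae_sum_dirac hw
      (hR.ae_eq_condExp (g := 0) (fun x => (hw x).le) (fun _ _ _ => rfl) (by simpa using h))

end Atoms

variable {T : ℕ} {Ξ Ξ' : Fin (T + 1) → Type*}

/-! ### Nodes as atoms of the filtrations -/

theorem sameNode_equivalence (P : ScenarioTree Ξ) (t : Fin (T + 1)) :
    Equivalence (P.SameNode t) :=
  ⟨fun _ _ _ => rfl, fun h s hs => (h s hs).symm, fun h h' s hs => (h s hs).trans (h' s hs)⟩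

theorem SameNode.mono {P : ScenarioTree Ξ} {s t : Fin (T + 1)} (hst : s ≤ t) {i j : P.Scenario}
    (h : P.SameNode t i j) : P.SameNode s i j :=
  fun u hu => h u (hu.trans hst)

theorem sameNode_last_iff {P : ScenarioTree Ξ} {i j : P.Scenario} :
    P.SameNode (Fin.last T) i j ↔ i = j :=
  ⟨fun h => Subtype.ext (funext fun s => h s (Fin.le_last s)), fun h => h ▸ fun _ _ => rfl⟩

theorem sameNode_congr {P : ScenarioTree Ξ} {t : Fin (T + 1)} {i j : P.Scenario}
    (h : P.SameNode t i j) (k : P.Scenario) : P.SameNode t i k ↔ P.SameNode t j k :=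
  ⟨(P.sameNode_equivalence t).trans ((P.sameNode_equivalence t).symm h),
    (P.sameNode_equivalence t).trans h⟩

/-- The atoms of `F_t` are the nodes of stage `t`. -/
theorem isAtomRel_filtration (P : ScenarioTree Ξ) (t : Fin (T + 1)) :
    IsAtomRel (P.filtration t) (P.SameNode t) where
  equiv := P.sameNode_equivalence t
  measurableSet_class x := by
    have : {y | P.SameNode t x y} = ⋂ s, ⋂ _ : s ≤ t, {y | P.path y s = P.path x s} := by
      ext y
      simp [SameNode, eq_comm]
    rw [this]
    refine MeasurableSet.iInter fun s => MeasurableSet.iInter fun hs => ?_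
    have hle : MeasurableSpace.comap (fun ω => P.path ω s) ⊤ ≤ P.filtration t :=
      le_iSup₂_of_le (f := fun s (_ : s ≤ t) => MeasurableSpace.comap (fun ω => P.path ω s) ⊤)
        s hs le_rfl
    exact hle _ ⟨{P.path x s}, trivial, rfl⟩
  mem_of_rel := by
    have hle : P.filtration t ≤
        MeasurableSpace.comap (fun ω (s : {s // s ≤ t}) => P.path ω s.1) ⊤ := by
      refine iSup₂_le fun s hs => ?_
      rintro _ ⟨u, -, rfl⟩
      exact ⟨{v | v ⟨s, hs⟩ ∈ u}, trivial, rfl⟩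
    intro s hs x y hxy hx
    obtain ⟨u, -, rfl⟩ := hle s hs
    have : (fun s : {s // s ≤ t} => P.path x s.1) = fun s : {s // s ≤ t} => P.path y s.1 :=
      funext fun s => hxy s.1 s.2
    simpa [Set.mem_preimage, ← this] using hx

theorem isAtomRel_prod (P : ScenarioTree Ξ) (Q : ScenarioTree Ξ') (s t : Fin (T + 1)) :
    IsAtomRel ((P.filtration s).prod (Q.filtration t))
      fun x y => P.SameNode s x.1 y.1 ∧ Q.SameNode t x.2 y.2 :=
  (P.isAtomRel_filtration s).prod (Q.isAtomRel_filtration t)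

theorem p_pos (P : ScenarioTree Ξ) (i : P.Scenario) : 0 < P.p i := P.prob_pos i

open Classical in
theorem proj_eq_zero_iff {P : ScenarioTree Ξ} {Q : ScenarioTree Ξ'} {t : Fin (T + 1)}
    {f : P.Scenario × Q.Scenario → ℝ} :
    proj P Q t f = 0 ↔ ∀ i j, ∑ i' with P.SameNode t i i', P.p i' * f (i', j) = 0 := by
  have h := fun j => (P.isAtomRel_filtration t).condExp_eq_zero_iff (f := fun ω => f (ω, j)) P.p_pos
  constructor
  · intro hf i j
    exact (h j).1 (fun i => congrFun hf (i, j)) i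
  · intro hf
    funext x
    exact (h x.2).2 (fun i => hf i x.2) x.1

open Classical in
theorem projTilde_eq_zero_iff {P : ScenarioTree Ξ} {Q : ScenarioTree Ξ'} {t : Fin (T + 1)}
    {f : P.Scenario × Q.Scenario → ℝ} :
    projTilde P Q t f = 0 ↔ ∀ i j, ∑ j' with Q.SameNode t j j', Q.p j' * f (i, j') = 0 := by
  have h := fun i => (Q.isAtomRel_filtration t).condExp_eq_zero_iff (f := fun ω => f (i, ω)) Q.p_pos
  constructor
  · intro hf i j
    exact (h i).1 (fun j => congrFun hf (i, j)) j
  · intro hf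
    funext x
    exact (h x.1).2 (fun j => hf x.1 j) x.2

/-! ### Linear form of the nested marginal constraints -/

open Classical in
/-- The first family of nested marginal constraints with the denominators cleared, which makes it
linear in `π`. The second family is the first one for `π ∘ Prod.swap`. -/
def FstMarginal (P : ScenarioTree Ξ) (Q : ScenarioTree Ξ') (π : P.Scenario × Q.Scenario → ℝ) :
    Prop :=
  ∀ t i j, ∑ j' with Q.SameNode t j j', π (i, j') = P.condProb t i * nodeMass P Q π t i j

theorem nodeMass_swap (P : ScenarioTree Ξ) (Q : ScenarioTree Ξ')
    (π : P.Scenario × Q.Scenario → ℝ) (t : Fin (T + 1)) (i : P.Scenario) (j : Q.Scenario) :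
    nodeMass Q P (π ∘ Prod.swap) t j i = nodeMass P Q π t i j := by
  unfold nodeMass
  rw [Finset.sum_comm]
  rfl

theorem nodeMass_congr {P : ScenarioTree Ξ} {Q : ScenarioTree Ξ'}
    (π : P.Scenario × Q.Scenario → ℝ) {t : Fin (T + 1)} {i i' : P.Scenario} {j j' : Q.Scenario}
    (hi : P.SameNode t i i') (hj : Q.SameNode t j j') :
    nodeMass P Q π t i' j' = nodeMass P Q π t i j := by
  have hP : P.SameNode t i' = P.SameNode t i := funext fun k => propext (sameNode_congr hi k).symm
  have hQ : Q.SameNode t j' = Q.SameNode t j := funext fun k => propext (sameNode_congr hj k).symm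
  unfold nodeMass
  rw [hP, hQ]

theorem nodeMass_pos {P : ScenarioTree Ξ} {Q : ScenarioTree Ξ'}
    {π : P.Scenario × Q.Scenario → ℝ} (hπ : ∀ x, 0 < π x) (t : Fin (T + 1)) (i : P.Scenario)
    (j : Q.Scenario) : 0 < nodeMass P Q π t i j := by
  classical
  refine Finset.sum_pos (fun i' _ => Finset.sum_pos (fun j' _ => hπ _) ⟨j, ?_⟩) ⟨i, ?_⟩
  · simpa using (Q.sameNode_equivalence t).refl j
  · simpa using (P.sameNode_equivalence t).refl i

theorem isNestedPlan_iff {P : ScenarioTree Ξ} {Q : ScenarioTree Ξ'}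
    {π : P.Scenario × Q.Scenario → ℝ} :
    IsNestedPlan P Q π ↔
      (∀ x, 0 < π x) ∧ ∑ x, π x = 1 ∧ FstMarginal P Q π ∧ FstMarginal Q P (π ∘ Prod.swap) := by
  classical
  have h₁ : (∀ x, 0 < π x) → ((∀ t i j, ∑ j' with Q.SameNode t j j',
      π (i, j') / nodeMass P Q π t i j' = P.condProb t i) ↔ FstMarginal P Q π) := by
    intro hπ
    refine forall_congr' fun t => forall_congr' fun i => forall_congr' fun j => ?_
    rw [← div_eq_iff (nodeMass_pos hπ t i j).ne', Finset.sum_div]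
    refine Eq.congr_left (Finset.sum_congr rfl fun j' hj' => ?_)
    rw [nodeMass_congr π ((P.sameNode_equivalence t).refl i) (Finset.mem_filter.1 hj').2]
  have h₂ : (∀ x, 0 < π x) → ((∀ t i j, ∑ i' with P.SameNode t i i',
      π (i', j) / nodeMass P Q π t i' j = Q.condProb t j) ↔
        FstMarginal Q P (π ∘ Prod.swap)) := by
    intro hπ
    refine forall_congr' fun t => forall_comm.trans ?_
    refine forall_congr' fun j => forall_congr' fun i => ?_
    rw [nodeMass_swap, ← div_eq_iff (nodeMass_pos hπ t i j).ne', Finset.sum_div]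
    refine Eq.congr_left (Finset.sum_congr rfl fun i' hi' => ?_)
    rw [nodeMass_congr π (Finset.mem_filter.1 hi').2 ((Q.sameNode_equivalence t).refl j)]
    rfl
  constructor
  · exact fun h => ⟨h.pos, h.sum_eq_one, (h₁ h.pos).1 h.fst_cond, (h₂ h.pos).1 h.snd_cond⟩
  · exact fun ⟨a, b, c, d⟩ => ⟨a, b, (h₁ a).2 c, (h₂ a).2 d⟩

theorem FstMarginal.add_smul {P : ScenarioTree Ξ} {Q : ScenarioTree Ξ'}
    {π ρ : P.Scenario × Q.Scenario → ℝ} (hπ : FstMarginal P Q π) (hρ : FstMarginal P Q ρ)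
    (a b : ℝ) : FstMarginal P Q (fun x => a * π x + b * ρ x) := by
  classical
  intro t i j
  have : nodeMass P Q (fun x => a * π x + b * ρ x) t i j =
      a * nodeMass P Q π t i j + b * nodeMass P Q ρ t i j := by
    simp only [nodeMass, Finset.sum_add_distrib, Finset.mul_sum]
  rw [this, Finset.sum_add_distrib, ← Finset.mul_sum, ← Finset.mul_sum, hπ, hρ]
  ring

open Classical in
theorem sum_p_pos (P : ScenarioTree Ξ) (t : Fin (T + 1)) (i : P.Scenario) :
    0 < ∑ i' with P.SameNode t i i', P.p i' :=
  Finset.sum_pos (fun i' _ => P.p_pos i') ⟨i, by simpa using (P.sameNode_equivalence t).refl i⟩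

theorem fstMarginal_prod (P : ScenarioTree Ξ) (Q : ScenarioTree Ξ') :
    FstMarginal P Q fun x => P.p x.1 * Q.p x.2 := by
  classical
  intro t i j
  have := (P.sum_p_pos t i).ne'
  simp only [nodeMass, ← Finset.mul_sum, ← Finset.sum_mul, condProb]
  field_simp

theorem sum_p (P : ScenarioTree Ξ) : ∑ i, P.p i = 1 := P.prob_sum

/-- The independent coupling is a nested plan. -/
theorem isNestedPlan_prod (P : ScenarioTree Ξ) (Q : ScenarioTree Ξ') :
    IsNestedPlan P Q fun x => P.p x.1 * Q.p x.2 := by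
  refine isNestedPlan_iff.2 ⟨fun x => mul_pos (P.p_pos _) (Q.p_pos _), ?_,
    fstMarginal_prod P Q, ?_⟩
  · simp only [Fintype.sum_prod_type, ← Finset.mul_sum, Q.sum_p, mul_one, P.sum_p]
  · convert fstMarginal_prod Q P using 2
    exact mul_comm _ _

/-! ### Increments of dual processes -/

open Classical in
/-- The increments `β̂` from stage `s` to stage `s + 1`: functions of the node `i_{s+1}` of the
first tree and the node `j_s` of the second tree whose conditional expectation given `i_s` is zero.
The increments `γ̂` are those functions for which `γ̂ ∘ Prod.swap` is an increment with the two
trees exchanged. -/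
structure IsIncrement (P : ScenarioTree Ξ) (Q : ScenarioTree Ξ') (s : Fin T)
    (β : P.Scenario × Q.Scenario → ℝ) : Prop where
  congr : ∀ x y, P.SameNode s.succ x.1 y.1 ∧ Q.SameNode s.castSucc x.2 y.2 → β x = β y
  sum_eq_zero : ∀ i j, ∑ i' with P.SameNode s.castSucc i i', P.p i' * β (i', j) = 0

theorem IsIncrement.add {P : ScenarioTree Ξ} {Q : ScenarioTree Ξ'} {s : Fin T}
    {β β' : P.Scenario × Q.Scenario → ℝ} (h : IsIncrement P Q s β) (h' : IsIncrement P Q s β') :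
    IsIncrement P Q s (β + β') where
  congr x y hxy := congrArg₂ (· + ·) (h.congr x y hxy) (h'.congr x y hxy)
  sum_eq_zero i j := by
    simp [mul_add, Finset.sum_add_distrib, h.sum_eq_zero, h'.sum_eq_zero]

theorem IsIncrement.smul {P : ScenarioTree Ξ} {Q : ScenarioTree Ξ'} {s : Fin T}
    {β : P.Scenario × Q.Scenario → ℝ} (h : IsIncrement P Q s β) (c : ℝ) :
    IsIncrement P Q s (c • β) where
  congr x y hxy := congrArg (c * ·) (h.congr x y hxy)
  sum_eq_zero i j := by
    simp [mul_left_comm _ c, ← Finset.mul_sum, h.sum_eq_zero]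

theorem isDualProcess_iff {P : ScenarioTree Ξ} {Q : ScenarioTree Ξ'} {m : ℝ}
    {M : Fin (T + 1) → P.Scenario × Q.Scenario → ℝ} :
    IsDualProcess P Q m M ↔ ∃ β γ : Fin T → P.Scenario × Q.Scenario → ℝ,
      (∀ s, IsIncrement P Q s (β s)) ∧ (∀ s, IsIncrement Q P s (γ s ∘ Prod.swap)) ∧
        ∀ t x, M t x = m + ∑ s with s.succ ≤ t, (β s x + γ s x) := by
  simp only [IsDualProcess, (isAtomRel_prod P Q _ _).measurable_iff, proj_eq_zero_iff,
    projTilde_eq_zero_iff]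
  refine exists_congr fun β => exists_congr fun γ => ⟨?_, ?_⟩
  · rintro ⟨h₁, h₂, h₃, h₄, h₅⟩
    exact ⟨fun s => ⟨h₁ s, h₃ s⟩, fun s => ⟨fun x y h => h₂ s x.swap y.swap h.symm,
      fun j i => h₄ s i j⟩, h₅⟩
  · rintro ⟨h₁, h₂, h₅⟩
    exact ⟨fun s => (h₁ s).congr, fun s x y h => (h₂ s).congr x.swap y.swap h.symm,
      fun s => (h₁ s).sum_eq_zero, fun s i j => (h₂ s).sum_eq_zero j i, h₅⟩

/-- The pairs of scenarios `x` and `y` pass through the same pair of nodes of stage `t`. -/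
def JointNode (P : ScenarioTree Ξ) (Q : ScenarioTree Ξ') (t : Fin (T + 1))
    (x y : P.Scenario × Q.Scenario) : Prop :=
  P.SameNode t x.1 y.1 ∧ Q.SameNode t x.2 y.2

/-- The atoms of `F_t ⊗ F̃_t` are the pairs of nodes of stage `t`. -/
theorem isAtomRel_jointFiltration (P : ScenarioTree Ξ) (Q : ScenarioTree Ξ') (t : Fin (T + 1)) :
    IsAtomRel (jointFiltration P Q t) (JointNode P Q t) :=
  isAtomRel_prod P Q t t

theorem JointNode.mono {P : ScenarioTree Ξ} {Q : ScenarioTree Ξ'} {s t : Fin (T + 1)}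
    (hst : s ≤ t) {x y : P.Scenario × Q.Scenario} (h : JointNode P Q t x y) :
    JointNode P Q s x y :=
  ⟨SameNode.mono hst h.1, SameNode.mono hst h.2⟩

open Classical in
theorem sum_jointNode {P : ScenarioTree Ξ} {Q : ScenarioTree Ξ'} (t : Fin (T + 1))
    (x : P.Scenario × Q.Scenario) (f : P.Scenario × Q.Scenario → ℝ) :
    ∑ y with JointNode P Q t x y, f y =
      ∑ i with P.SameNode t x.1 i, ∑ j with Q.SameNode t x.2 j, f (i, j) := by
  rw [← Finset.sum_product']
  refine Finset.sum_congr ?_ fun _ _ => rfl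
  ext y
  simp only [Finset.mem_filter, Finset.mem_product, Finset.mem_univ, true_and]
  rfl

open Classical in
/-- Increments are martingale differences under every `π` satisfying the nested constraints: given
the pair `(i_s, j_s)`, the first path has under `π` its conditional law under `P`, and the increment
depends on the second path only through `j_s`. -/
theorem IsIncrement.sum_node_eq_zero {P : ScenarioTree Ξ} {Q : ScenarioTree Ξ'} {s : Fin T}
    {β π : P.Scenario × Q.Scenario → ℝ} (hβ : IsIncrement P Q s β) (hπ : FstMarginal P Q π)
    (x : P.Scenario × Q.Scenario) :
    ∑ y with JointNode P Q s.castSucc x y, π y * β y = 0 := by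
  obtain ⟨i, j⟩ := x
  rw [sum_jointNode]
  calc _ = ∑ i' with P.SameNode s.castSucc i i', (nodeMass P Q π s.castSucc i j /
          ∑ i'' with P.SameNode s.castSucc i i'', P.p i'') * (P.p i' * β (i', j)) := by
        refine Finset.sum_congr rfl fun i' hi' => ?_
        have hi := (Finset.mem_filter.1 hi').2
        have : ∀ j' ∈ Finset.univ.filter (Q.SameNode s.castSucc j),
            π (i', j') * β (i', j') = π (i', j') * β (i', j) := fun j' hj' => by
          rw [hβ.congr (i', j') (i', j) ⟨(P.sameNode_equivalence _).refl _,
            (Q.sameNode_equivalence _).symm (Finset.mem_filter.1 hj').2⟩]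
        rw [Finset.sum_congr rfl this, ← Finset.sum_mul, hπ,
          nodeMass_congr π hi ((Q.sameNode_equivalence _).refl j), condProb]
        simp only [← sameNode_congr hi]
        ring
    _ = 0 := by rw [← Finset.mul_sum, hβ.sum_eq_zero, mul_zero]

open Classical in
theorem IsIncrement.sum_node_swap_eq_zero {P : ScenarioTree Ξ} {Q : ScenarioTree Ξ'} {s : Fin T}
    {γ π : P.Scenario × Q.Scenario → ℝ} (hγ : IsIncrement Q P s (γ ∘ Prod.swap))
    (hπ : FstMarginal Q P (π ∘ Prod.swap)) (x : P.Scenario × Q.Scenario) :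
    ∑ y with JointNode P Q s.castSucc x y, π y * γ y = 0 := by
  rw [← hγ.sum_node_eq_zero hπ x.swap]
  refine Finset.sum_equiv (Equiv.prodComm _ _) (fun y => ?_) (fun y _ => rfl)
  simp only [Finset.mem_filter, Finset.mem_univ, true_and]
  exact and_comm

/-- The terminal values `M_T` of the dual processes `M`, with arbitrary `M₀`. -/
def dualSpace (P : ScenarioTree Ξ) (Q : ScenarioTree Ξ') :
    Submodule ℝ (P.Scenario × Q.Scenario → ℝ) where
  carrier := {f | ∃ (m : ℝ) (β γ : Fin T → P.Scenario × Q.Scenario → ℝ),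
    (∀ s, IsIncrement P Q s (β s)) ∧ (∀ s, IsIncrement Q P s (γ s ∘ Prod.swap)) ∧
      ∀ x, f x = m + ∑ s, (β s x + γ s x)}
  zero_mem' := ⟨0, 0, 0, fun _ => ⟨fun _ _ _ => rfl, by simp⟩, fun _ => ⟨fun _ _ _ => rfl,
    by simp⟩, by simp⟩
  add_mem' := by
    rintro f g ⟨m, β, γ, h₁, h₂, h₃⟩ ⟨m', β', γ', h₁', h₂', h₃'⟩
    exact ⟨m + m', β + β', γ + γ', fun s => (h₁ s).add (h₁' s), fun s => (h₂ s).add (h₂' s),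
      fun x => by
        simp only [Pi.add_apply, h₃, h₃', Finset.sum_add_distrib]
        ring⟩
  smul_mem' := by
    rintro c f ⟨m, β, γ, h₁, h₂, h₃⟩
    exact ⟨c * m, c • β, c • γ, fun s => (h₁ s).smul c, fun s => (h₂ s).smul c, fun x => by
      simp only [Pi.smul_apply, smul_eq_mul, h₃, Finset.sum_add_distrib, mul_add, Finset.mul_sum]⟩

theorem swap_mem_dualSpace {P : ScenarioTree Ξ} {Q : ScenarioTree Ξ'}
    {f : P.Scenario × Q.Scenario → ℝ} (hf : f ∘ Prod.swap ∈ dualSpace Q P) :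
    f ∈ dualSpace P Q := by
  obtain ⟨m, β, γ, h₁, h₂, h₃⟩ := hf
  exact ⟨m, fun s => γ s ∘ Prod.swap, fun s => β s ∘ Prod.swap, h₂, h₁, fun x =>
    (h₃ x.swap).trans (by simp [add_comm])⟩

open Classical in
/-- The linear functionals `π ↦ ∑_{j' ≻ j_t} π(i, j') - P(i ∣ i_t) ∑_{i' ≻ i_t, j' ≻ j_t} π(i', j')`
defining the nested constraints are represented by elements of `dualSpace`: the function
`1_{i} - P(i ∣ i_t) 1_{i' ≻ i_t}` is the sum of the martingale differences of the conditional
probabilities of `i` from stage `t` on. -/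
theorem constraint_mem_dualSpace (P : ScenarioTree Ξ) (Q : ScenarioTree Ξ') (t : Fin (T + 1))
    (i : P.Scenario) (j : Q.Scenario) :
    (fun x => (if Q.SameNode t j x.2 then 1 else 0) *
      ((if i = x.1 then 1 else 0) - if P.SameNode t i x.1 then P.condProb t i else 0)) ∈
        dualSpace P Q := by
  let a : Fin (T + 1) → P.Scenario → ℝ := fun s i' =>
    if P.SameNode s i i' then P.condProb s i else 0
  -- Freezing the martingale `a` up to stage `t` makes its increments before stage `t` vanish.
  let b : Fin (T + 1) → P.Scenario → ℝ := fun s => a (max t s)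
  have ha : ∀ s u i₀, u ≤ s → ∑ i' with P.SameNode u i₀ i', P.p i' * a s i' =
      if P.SameNode u i₀ i then P.p i else 0 := by
    intro s u i₀ hus
    rw [Finset.sum_filter]
    have : ∀ i', (if P.SameNode u i₀ i' then P.p i' * a s i' else 0) =
        (if P.SameNode u i₀ i then P.condProb s i else 0) *
          if P.SameNode s i i' then P.p i' else 0 := by
      intro i'
      by_cases h : P.SameNode s i i'
      · have : P.SameNode u i₀ i' ↔ P.SameNode u i₀ i :=
          ⟨fun h' => (P.sameNode_equivalence u).trans h'
            ((P.sameNode_equivalence u).symm (h.mono hus)),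
          fun h' => (P.sameNode_equivalence u).trans h' (h.mono hus)⟩
        simp only [a, h, this, if_true]
        split_ifs <;> ring
      · simp [a, h]
    simp only [this, ← Finset.mul_sum, ← Finset.sum_filter]
    have := (P.sum_p_pos s i).ne'
    split_ifs
    · rw [condProb]; field_simp
    · simp
  have hcongr : ∀ s u i₁ i₂, s ≤ u → P.SameNode u i₁ i₂ → a s i₁ = a s i₂ := by
    intro s u i₁ i₂ hsu h
    have : P.SameNode s i i₁ ↔ P.SameNode s i i₂ :=
      ⟨fun h' => (P.sameNode_equivalence s).trans h' (h.mono hsu), fun h' =>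
        (P.sameNode_equivalence s).trans h' ((P.sameNode_equivalence s).symm (h.mono hsu))⟩
    simp only [a, this]
  refine ⟨0, fun s x => (if Q.SameNode t j x.2 then 1 else 0) *
    (b s.succ x.1 - b s.castSucc x.1), 0, fun s => ⟨?_, ?_⟩,
    fun _ => ⟨fun _ _ _ => rfl, by simp⟩, ?_⟩
  · rintro ⟨i₁, j₁⟩ ⟨i₂, j₂⟩ ⟨hi, hj⟩
    have hs := Fin.castSucc_lt_succ (i := s)
    rcases le_or_gt t s.castSucc with h | h
    · have h' := h.trans hs.le
      have : Q.SameNode t j j₁ ↔ Q.SameNode t j j₂ :=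
        ⟨fun h₁ => (Q.sameNode_equivalence t).trans h₁ (hj.mono h), fun h₁ =>
          (Q.sameNode_equivalence t).trans h₁ ((Q.sameNode_equivalence t).symm (hj.mono h))⟩
      simp only [b, max_eq_right h, max_eq_right h', this, hcongr _ _ _ _ le_rfl hi,
        hcongr _ _ _ _ hs.le hi]
    · have h' : s.succ ≤ t := Fin.castSucc_lt_iff_succ_le.1 h
      simp only [b, max_eq_left h.le, max_eq_left h', sub_self, mul_zero]
  · intro i₀ j₀
    change ∑ i' with P.SameNode s.castSucc i₀ i', P.p i' *
      ((if Q.SameNode t j j₀ then 1 else 0) * (b s.succ i' - b s.castSucc i')) = 0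
    simp only [mul_left_comm (P.p _)]
    rw [← Finset.mul_sum]
    simp only [mul_sub (P.p _), Finset.sum_sub_distrib, b]
    rw [ha _ _ _ ((Fin.castSucc_lt_succ (i := s)).le.trans (le_max_right _ _)),
      ha _ _ _ (le_max_right _ _), sub_self, mul_zero]
  · intro x
    have h₁ := Fin.sum_univ_succ fun s => b s x.1
    have h₂ := Fin.sum_univ_castSucc fun s => b s x.1
    have hT : b (Fin.last T) x.1 = if i = x.1 then 1 else 0 := by
      have : P.condProb (Fin.last T) i = 1 := by
        simp [condProb, sameNode_last_iff, Finset.sum_filter, (P.p_pos i).ne']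
      simp only [b, a, max_eq_right (Fin.le_last t), sameNode_last_iff, this]
    have h0 : b 0 x.1 = if P.SameNode t i x.1 then P.condProb t i else 0 := by
      simp only [b, a, max_eq_left (Fin.zero_le t)]
    simp only [Pi.zero_apply, add_zero, zero_add, ← Finset.mul_sum, Finset.sum_sub_distrib]
    rw [← hT, ← h0]
    congr 1
    linarith

/-- Functions orthogonal to `dualSpace` satisfy the nested constraints. -/
theorem fstMarginal_of_orthogonal {P : ScenarioTree Ξ} {Q : ScenarioTree Ξ'}
    {h : P.Scenario × Q.Scenario → ℝ} (hh : ∀ f ∈ dualSpace P Q, ∑ x, h x * f x = 0) :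
    FstMarginal P Q h := by
  classical
  intro t i j
  have := hh _ (constraint_mem_dualSpace P Q t i j)
  rw [← sub_eq_zero, ← this]
  simp only [nodeMass, Finset.sum_filter, Fintype.sum_prod_type, mul_sub, Finset.sum_sub_distrib]
  congr 1
  · simp
  · rw [Finset.mul_sum]
    refine Finset.sum_congr rfl fun i' _ => ?_
    split_ifs
    · rw [Finset.mul_sum]
      refine Finset.sum_congr rfl fun j' _ => ?_
      split_ifs <;> ring
    · simp

/-! ### Dual processes are martingales under nested plans -/

open Classical in
theorem sum_coarser_node_eq_zero {P : ScenarioTree Ξ} {Q : ScenarioTree Ξ'}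
    {s t : Fin (T + 1)} (hst : s ≤ t) {f : P.Scenario × Q.Scenario → ℝ}
    (hf : ∀ x, ∑ y with JointNode P Q t x y, f y = 0) (x : P.Scenario × Q.Scenario) :
    ∑ y with JointNode P Q s x y, f y = 0 := by
  have hs := (isAtomRel_jointFiltration P Q s).equiv
  have := sum_mul_eq_zero_of_class_sums (isAtomRel_jointFiltration P Q t).equiv hf
    (h := fun y => if JointNode P Q s x y then 1 else 0) fun y z hyz =>
      if_congr ⟨fun h => hs.trans h (hyz.mono hst), fun h => hs.trans h (hs.symm (hyz.mono hst))⟩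
        rfl rfl
  simpa [Finset.sum_filter] using this

theorem IsDualProcess.martingale {P : ScenarioTree Ξ} {Q : ScenarioTree Ξ'} {m : ℝ}
    {M : Fin (T + 1) → P.Scenario × Q.Scenario → ℝ} (hM : IsDualProcess P Q m M)
    {π : P.Scenario × Q.Scenario → ℝ} (hπ : IsNestedPlan P Q π) :
    Martingale M (jointFiltration P Q) (planMeasure P Q π) := by
  classical
  obtain ⟨β, γ, hβ, hγ, hM⟩ := isDualProcess_iff.1 hM
  obtain ⟨hpos, -, h₁, h₂⟩ := isNestedPlan_iff.1 hπ
  have hinv : ∀ t x y, JointNode P Q t x y → M t x = M t y := by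
    intro t x y h
    rw [hM, hM]
    congr 1
    refine Finset.sum_congr rfl fun s hs => ?_
    have hs := (Finset.mem_filter.1 hs).2
    have hs' := (Fin.castSucc_lt_succ (i := s)).le.trans hs
    exact congrArg₂ (· + ·) ((hβ s).congr x y ⟨SameNode.mono hs h.1, SameNode.mono hs' h.2⟩)
      ((hγ s).congr x.swap y.swap ⟨SameNode.mono hs h.2, SameNode.mono hs' h.1⟩)
  refine ⟨fun t => ((isAtomRel_jointFiltration P Q t).measurable_iff.2 (hinv t)).stronglyMeasurable,
    fun s t hst => ?_⟩
  refine (isAtomRel_jointFiltration P Q s).ae_eq_condExp (fun x => (hpos x).le) (hinv s) fun x => ?_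
  have hdiff : ∀ y, π y * (M t y - M s y) = ∑ k, ((if k.succ ≤ t then 1 else 0) -
      if k.succ ≤ s then 1 else 0) * (π y * β k y + π y * γ k y) := by
    intro y
    rw [hM, hM, add_sub_add_left_eq_sub, Finset.sum_filter, Finset.sum_filter,
      ← Finset.sum_sub_distrib, Finset.mul_sum]
    refine Finset.sum_congr rfl fun k _ => ?_
    split_ifs <;> ring
  simp only [hdiff]
  rw [Finset.sum_comm]
  refine Finset.sum_eq_zero fun k _ => ?_
  rw [← Finset.mul_sum]
  by_cases hk : k.succ ≤ s
  · simp [hk, hk.trans hst]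
  · have hk : s ≤ k.castSucc := Fin.le_castSucc_iff.2 (not_le.1 hk)
    rw [Finset.sum_add_distrib,
      sum_coarser_node_eq_zero hk fun x => (hβ k).sum_node_eq_zero h₁ x,
      sum_coarser_node_eq_zero hk fun x => (hγ k).sum_node_swap_eq_zero h₂ x, add_zero, mul_zero]

theorem IsDualProcess.sum_mul_eq {P : ScenarioTree Ξ} {Q : ScenarioTree Ξ'} {m : ℝ}
    {M : Fin (T + 1) → P.Scenario × Q.Scenario → ℝ} (hM : IsDualProcess P Q m M)
    {π : P.Scenario × Q.Scenario → ℝ} (hπ : IsNestedPlan P Q π) (t : Fin (T + 1)) :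
    ∑ x, π x * M t x = m := by
  classical
  obtain ⟨β, γ, hβ, hγ, hM⟩ := isDualProcess_iff.1 hM
  obtain ⟨-, hsum, h₁, h₂⟩ := isNestedPlan_iff.1 hπ
  simp only [hM, mul_add, Finset.sum_add_distrib, ← Finset.sum_mul, hsum, one_mul, Finset.mul_sum]
  rw [Finset.sum_comm, Finset.sum_comm (s := Finset.univ) (f := fun x k => π x * γ k x)]
  have hb : ∀ k, ∑ x, π x * β k x = 0 := fun k => by
    simpa using sum_mul_eq_zero_of_class_sums (h := fun _ => 1)
      (isAtomRel_jointFiltration P Q k.castSucc).equiv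
      (fun x => (hβ k).sum_node_eq_zero h₁ x) (fun _ _ _ => rfl)
  have hc : ∀ k, ∑ x, π x * γ k x = 0 := fun k => by
    simpa using sum_mul_eq_zero_of_class_sums (h := fun _ => 1)
      (isAtomRel_jointFiltration P Q k.castSucc).equiv
      (fun x => (hγ k).sum_node_swap_eq_zero h₂ x) (fun _ _ _ => rfl)
  simp [hb, hc]

/-! ### Weak duality -/

/-- Gibbs' inequality with its equality case, for positive functions of equal sum. -/
theorem sum_mul_log_le {α : Type*} [Fintype α] {p q : α → ℝ} (hp : ∀ x, 0 < p x)
    (hq : ∀ x, 0 < q x) (hpq : ∑ x, p x = ∑ x, q x) :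
    ∑ x, p x * Real.log (q x) ≤ ∑ x, p x * Real.log (p x) ∧
      (∑ x, p x * Real.log (q x) = ∑ x, p x * Real.log (p x) → p = q) := by
  have hle : ∀ x, p x * Real.log (q x) ≤ p x * Real.log (p x) + (q x - p x) := by
    intro x
    have := Real.log_le_sub_one_of_pos (div_pos (hq x) (hp x))
    rw [Real.log_div (hq x).ne' (hp x).ne'] at this
    have h := mul_le_mul_of_nonneg_left this (hp x).le
    have e : p x * (q x / p x - 1) = q x - p x := by
      have := (hp x).ne'
      field_simp
    linarith
  have hsum : ∑ x, (p x * Real.log (p x) + (q x - p x)) = ∑ x, p x * Real.log (p x) := by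
    rw [Finset.sum_add_distrib, Finset.sum_sub_distrib, hpq, sub_self, add_zero]
  refine ⟨hsum ▸ Finset.sum_le_sum fun x _ => hle x, fun h => ?_⟩
  rw [← hsum, Finset.sum_eq_sum_iff_of_le fun x _ => hle x] at h
  funext x
  by_contra hne
  have := Real.log_lt_sub_one_of_pos (div_pos (hq x) (hp x))
    (fun h => hne ((div_eq_one_iff_eq (hp x).ne').1 h).symm)
  rw [Real.log_div (hq x).ne' (hp x).ne'] at this
  have h' := mul_lt_mul_of_pos_left this (hp x)
  have e : p x * (q x / p x - 1) = q x - p x := by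
    have := (hp x).ne'
    field_simp
  linarith [h x (Finset.mem_univ x)]

/-- A dual feasible number `m` is at most the primal objective plus `1/λ`, with equality only if
the plan is the Gibbs mass function of the dual process; this is Gibbs' inequality, since `m` is
the mean of `M_T` under the plan and `M_T = d^r + (log gibbs + 1)/λ`. -/
theorem weak_duality {P : ScenarioTree Ξ} {Q : ScenarioTree Ξ'}
    {d : (∀ t, Ξ t) → (∀ t, Ξ' t) → ℝ} {r lam : ℝ} (hlam : 0 < lam) {m : ℝ}
    {M : Fin (T + 1) → P.Scenario × Q.Scenario → ℝ} (hM : IsDualFeasible P Q d r lam m M)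
    {π : P.Scenario × Q.Scenario → ℝ} (hπ : IsNestedPlan P Q π) :
    m ≤ entropicCost P Q d r lam π + 1 / lam ∧
      (m = entropicCost P Q d r lam π + 1 / lam ↔ π = gibbs P Q d r lam M) := by
  obtain ⟨hM, hG⟩ := hM
  have hm := hM.sum_mul_eq hπ (Fin.last T)
  have key : m = ∑ x, π x * cost P Q d r x +
      1 / lam * ∑ x, π x * Real.log (gibbs P Q d r lam M x) + 1 / lam := by
    have hlog : ∀ x, π x * M (Fin.last T) x = π x * cost P Q d r x +
        1 / lam * (π x * Real.log (gibbs P Q d r lam M x)) + π x * (1 / lam) := by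
      intro x
      rw [gibbs, Real.log_exp]
      field_simp
      ring
    rw [← hm, Finset.sum_congr rfl fun x _ => hlog x, Finset.sum_add_distrib,
      Finset.sum_add_distrib, ← Finset.mul_sum, ← Finset.sum_mul, hπ.sum_eq_one, one_mul]
  have hF : entropicCost P Q d r lam π = ∑ x, π x * cost P Q d r x +
      1 / lam * ∑ x, π x * Real.log (π x) := by
    rw [entropicCost, Finset.sum_add_distrib, Finset.mul_sum]
  obtain ⟨hle, heq⟩ := sum_mul_log_le hπ.pos (q := gibbs P Q d r lam M)
    (fun x => Real.exp_pos _) (hπ.sum_eq_one.trans hG.symm)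
  have hl : 0 < 1 / lam := one_div_pos.2 hlam
  refine ⟨?_, fun h => heq ?_, fun h => ?_⟩
  · rw [key, hF]
    have := mul_le_mul_of_nonneg_left hle hl.le
    linarith
  · rw [key, hF] at h
    exact mul_left_cancel₀ hl.ne' (by linarith)
  · rw [key, hF, ← h]

/-! ### Existence of a primal minimizer -/

theorem mul_log_convex {a b ε : ℝ} (ha : 0 ≤ a) (hb : 0 < b) (hε : 0 < ε) (hε' : ε < 1) :
    ((1 - ε) * a + ε * b) * Real.log ((1 - ε) * a + ε * b) ≤
      (1 - ε) * (a * Real.log a) + ε * (b * Real.log b) +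
        if a = 0 then ε * Real.log ε * b else 0 := by
  split_ifs with h
  · subst h
    rw [mul_zero, zero_add, Real.log_mul hε.ne' hb.ne']
    apply le_of_eq
    ring
  · have := Real.convexOn_mul_log.2 (Set.mem_Ici.2 ha) (Set.mem_Ici.2 hb.le)
      (sub_nonneg.2 hε'.le) hε.le (by ring)
    simpa using this

theorem isClosed_fstMarginal (P : ScenarioTree Ξ) (Q : ScenarioTree Ξ') :
    IsClosed {π | FstMarginal P Q π} := by
  simp only [FstMarginal, nodeMass, Set.ofPred_forall]
  refine isClosed_iInter fun t => isClosed_iInter fun i => isClosed_iInter fun j => ?_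
  exact isClosed_eq (by fun_prop) (by fun_prop)

/-- The minimizer over the compact set of nonnegative solutions of the constraints is strictly
positive, because moving from a zero of it towards the independent coupling decreases the
objective at infinite rate. -/
theorem exists_isOptimalPlan (P : ScenarioTree Ξ) (Q : ScenarioTree Ξ')
    (d : (∀ t, Ξ t) → (∀ t, Ξ' t) → ℝ) (r : ℝ) {lam : ℝ} (hlam : 0 < lam) :
    ∃ π, IsOptimalPlan P Q d r lam π := by
  classical
  let K : Set (P.Scenario × Q.Scenario → ℝ) := {π | (∀ x, 0 ≤ π x) ∧ ∑ x, π x = 1 ∧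
    FstMarginal P Q π ∧ FstMarginal Q P (π ∘ Prod.swap)}
  have hK : IsCompact K := by
    refine (isCompact_univ_pi fun _ => isCompact_Icc (a := (0 : ℝ)) (b := 1)).of_isClosed_subset
      ?_ ?_
    · refine .inter ?_ (.inter (isClosed_eq (by fun_prop) continuous_const)
        (.inter (isClosed_fstMarginal P Q) ?_))
      · change IsClosed {π : P.Scenario × Q.Scenario → ℝ | ∀ x, 0 ≤ π x}
        simp only [Set.ofPred_forall]
        exact isClosed_iInter fun x => isClosed_le continuous_const (continuous_apply x)
      · exact (isClosed_fstMarginal Q P).preimage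
          (f := fun π : P.Scenario × Q.Scenario → ℝ => π ∘ Prod.swap) (by fun_prop)
    · rintro π ⟨h₀, h₁, -⟩ x -
      exact ⟨h₀ x, h₁ ▸ Finset.single_le_sum (fun y _ => h₀ y) (Finset.mem_univ x)⟩
  have hρ := isNestedPlan_prod P Q
  have hne : K.Nonempty := ⟨_, by
    obtain ⟨a, b⟩ := isNestedPlan_iff.1 hρ
    exact ⟨fun x => (a x).le, b⟩⟩
  have hcont : Continuous (entropicCost P Q d r lam) := by
    unfold entropicCost
    have := Real.continuous_mul_log
    refine continuous_finsetSum _ fun x _ => ?_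
    exact ((continuous_apply x).mul continuous_const).add
      (continuous_const.mul (this.comp (continuous_apply x)))
  obtain ⟨π, ⟨h₀, h₁, h₂, h₃⟩, hmin⟩ := hK.exists_isMinOn hne hcont.continuousOn
  set ρ : P.Scenario × Q.Scenario → ℝ := fun x => P.p x.1 * Q.p x.2 with hρdef
  obtain ⟨ρ₀, ρ₁, ρ₂, ρ₃⟩ := isNestedPlan_iff.1 hρ
  have hpos : ∀ x, 0 < π x := by
    by_contra hcon
    push Not at hcon
    obtain ⟨x₀, hx₀⟩ := hcon
    have hx₀ : π x₀ = 0 := le_antisymm hx₀ (h₀ x₀)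
    set F := entropicCost P Q d r lam with hF
    set B := ∑ x, if π x = 0 then ρ x else 0 with hB
    have hBpos : 0 < B := Finset.sum_pos' (fun x _ => by split_ifs; exacts [(ρ₀ x).le, le_rfl])
      ⟨x₀, Finset.mem_univ _, by simpa [hx₀] using ρ₀ x₀⟩
    have hstep : ∀ ε, 0 < ε → ε < 1 → F π ≤ F ρ + 1 / lam * Real.log ε * B := by
      intro ε hε hε'
      have hmem : (fun x => (1 - ε) * π x + ε * ρ x) ∈ K := by
        refine ⟨fun x => add_nonneg (mul_nonneg (sub_nonneg.2 hε'.le) (h₀ x))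
          (mul_nonneg hε.le (ρ₀ x).le), ?_, h₂.add_smul ρ₂ _ _, h₃.add_smul ρ₃ _ _⟩
        rw [Finset.sum_add_distrib, ← Finset.mul_sum, ← Finset.mul_sum, h₁, ρ₁]
        ring
      have hle : F π ≤ F (fun x => (1 - ε) * π x + ε * ρ x) := hmin hmem
      have hconv : F (fun x => (1 - ε) * π x + ε * ρ x) ≤
          (1 - ε) * F π + ε * F ρ + ε * (1 / lam * Real.log ε * B) := by
        simp only [hF, entropicCost, hB, Finset.mul_sum, ← Finset.sum_add_distrib]
        refine Finset.sum_le_sum fun x _ => ?_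
        have := mul_le_mul_of_nonneg_left (mul_log_convex (h₀ x) (ρ₀ x) hε hε')
          (one_div_pos.2 hlam).le
        refine (add_le_add_right this _).trans (le_of_eq ?_)
        split_ifs <;> ring
      have : ε * F π ≤ ε * (F ρ + 1 / lam * Real.log ε * B) := by linarith
      exact le_of_mul_le_mul_left this hε
    -- The choice of `ε` makes the right-hand side of `hstep` at most `F π - 1`.
    have hC : 0 < |F ρ - F π| + 1 := by positivity
    have := hstep (Real.exp (-(lam / B * (|F ρ - F π| + 1)))) (Real.exp_pos _)
      (Real.exp_lt_one_iff.2 (neg_lt_zero.2 (by positivity)))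
    rw [Real.log_exp] at this
    have e : 1 / lam * -(lam / B * (|F ρ - F π| + 1)) * B = -(|F ρ - F π| + 1) := by
      field_simp
    rw [e] at this
    linarith [le_abs_self (F ρ - F π)]
  refine ⟨π, isNestedPlan_iff.2 ⟨hpos, h₁, h₂, h₃⟩, fun σ hσ => ?_⟩
  obtain ⟨a, b⟩ := isNestedPlan_iff.1 hσ
  exact hmin ⟨fun x => (a x).le, b⟩

/-! ### Strong duality -/

/-- The gradient of the objective at an optimal plan is orthogonal to all directions orthogonal to
`dualSpace`, as these are feasible; hence it lies in `dualSpace`. -/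
theorem IsOptimalPlan.gradient_mem_dualSpace {P : ScenarioTree Ξ} {Q : ScenarioTree Ξ'}
    {d : (∀ t, Ξ t) → (∀ t, Ξ' t) → ℝ} {r lam : ℝ} {π : P.Scenario × Q.Scenario → ℝ}
    (hπ : IsOptimalPlan P Q d r lam π) :
    (fun x => cost P Q d r x + 1 / lam * (Real.log (π x) + 1)) ∈ dualSpace P Q := by
  classical
  obtain ⟨hπ, hmin⟩ := hπ
  obtain ⟨hpos, hsum, h₁, h₂⟩ := isNestedPlan_iff.1 hπ
  by_contra hcon
  obtain ⟨φ, hφ, hle⟩ := Submodule.exists_le_ker_of_notMem hcon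
  set h : P.Scenario × Q.Scenario → ℝ := fun x => φ (Pi.single x 1) with hh
  have hφ_eq : ∀ f, φ f = ∑ x, h x * f x := by
    intro f
    rw [LinearMap.pi_apply_eq_sum_univ φ f]
    refine Finset.sum_congr rfl fun x _ => ?_
    rw [smul_eq_mul, mul_comm, hh]
    congr 2
    ext y
    simp [Pi.single_apply, eq_comm]
  have horth : ∀ f ∈ dualSpace P Q, ∑ x, h x * f x = 0 := fun f hf => by
    rw [← hφ_eq]
    exact hle hf
  have hone : ∑ x, h x = 0 := by
    have := horth (fun _ => 1) ⟨1, 0, 0, fun _ => ⟨fun _ _ _ => rfl, by simp⟩,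
      fun _ => ⟨fun _ _ _ => rfl, by simp⟩, by simp⟩
    simpa using this
  have h₃ : FstMarginal P Q h := fstMarginal_of_orthogonal horth
  have h₄ : FstMarginal Q P (h ∘ Prod.swap) := by
    refine fstMarginal_of_orthogonal fun f hf => ?_
    rw [← horth (f ∘ Prod.swap) (swap_mem_dualSpace (by simpa [Function.comp_assoc] using hf))]
    exact (Equiv.prodComm _ _).sum_comp (fun x => h x * f x.swap)
  have hfeas : ∀ᶠ ε in nhds (0 : ℝ), IsNestedPlan P Q fun x => 1 * π x + ε * h x := by
    have : ∀ᶠ ε in nhds (0 : ℝ), ∀ x, 0 < 1 * π x + ε * h x := by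
      refine Filter.eventually_all.2 fun x => ?_
      have hc : Continuous fun ε : ℝ => 1 * π x + ε * h x := by fun_prop
      exact hc.continuousAt.eventually_const_lt (by simpa using hpos x)
    filter_upwards [this] with ε hε
    refine isNestedPlan_iff.2 ⟨hε, ?_, h₁.add_smul h₃ _ _, h₂.add_smul h₄ _ _⟩
    rw [Finset.sum_add_distrib, ← Finset.mul_sum, ← Finset.mul_sum, hsum, hone]
    ring
  have hloc : IsLocalMin (fun ε : ℝ => entropicCost P Q d r lam fun x => 1 * π x + ε * h x) 0 := by
    filter_upwards [hfeas] with ε hε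
    simpa using hmin _ hε
  have hderiv : HasDerivAt (fun ε : ℝ => entropicCost P Q d r lam fun x => 1 * π x + ε * h x)
      (∑ x, (h x * cost P Q d r x + 1 / lam * ((Real.log (π x) + 1) * h x))) 0 := by
    unfold entropicCost
    refine HasDerivAt.fun_sum fun x _ => ?_
    have hlin : HasDerivAt (fun ε : ℝ => 1 * π x + ε * h x) (h x) 0 := by
      simpa using ((hasDerivAt_id (0 : ℝ)).mul_const (h x)).const_add (1 * π x)
    have hlog := Real.hasDerivAt_mul_log (x := 1 * π x + 0 * h x) (by simpa using (hpos x).ne')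
    have := hlog.comp (0 : ℝ) hlin
    simp only [one_mul, zero_mul, add_zero] at this hlin ⊢
    exact (hlin.mul_const _).add (this.const_mul _)
  apply hφ
  rw [hφ_eq, ← hloc.hasDerivAt_eq_zero hderiv]
  exact Finset.sum_congr rfl fun x _ => by ring

/-- Every optimal plan is the Gibbs mass function of a dual feasible process. -/
theorem IsOptimalPlan.exists_dual {P : ScenarioTree Ξ} {Q : ScenarioTree Ξ'}
    {d : (∀ t, Ξ t) → (∀ t, Ξ' t) → ℝ} {r lam : ℝ} (hlam : 0 < lam)
    {π : P.Scenario × Q.Scenario → ℝ} (hπ : IsOptimalPlan P Q d r lam π) :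
    ∃ m M, IsDualFeasible P Q d r lam m M ∧ π = gibbs P Q d r lam M := by
  obtain ⟨m, β, γ, hβ, hγ, hf⟩ := hπ.gradient_mem_dualSpace
  refine ⟨m, fun t x => m + ∑ s with s.succ ≤ t, (β s x + γ s x), ?_⟩
  have hG : π = gibbs P Q d r lam fun t x => m + ∑ s with s.succ ≤ t, (β s x + γ s x) := by
    funext x
    simp only [gibbs, Fin.le_last, Finset.filter_true, ← hf]
    have : -lam * (cost P Q d r x - (cost P Q d r x + 1 / lam * (Real.log (π x) + 1))) - 1 =
        Real.log (π x) := by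
      field_simp
      ring
    rw [this, Real.exp_log (hπ.1.pos x)]
  exact ⟨⟨isDualProcess_iff.2 ⟨β, γ, hβ, hγ, fun _ _ => rfl⟩, hG ▸ hπ.1.sum_eq_one⟩, hG⟩

end ScenarioTree

theorem mainTheorem7 {T : ℕ} {Ξ Ξ' : Fin (T + 1) → Type*}
    (P : ScenarioTree Ξ) (Q : ScenarioTree Ξ')
    (d : (∀ t, Ξ t) → (∀ t, Ξ' t) → ℝ) (r lam : ℝ) (hr : 1 ≤ r) (hlam : 0 < lam) :
    (∃! π, ScenarioTree.IsOptimalPlan P Q d r lam π) ∧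
    (∃ M₀ M, ScenarioTree.IsDualOptimal P Q d r lam M₀ M) ∧
    ∀ M₀ M π, ScenarioTree.IsDualOptimal P Q d r lam M₀ M →
      ScenarioTree.IsOptimalPlan P Q d r lam π →
        (∀ x, π x = ScenarioTree.gibbs P Q d r lam M x) ∧
        Martingale M (ScenarioTree.jointFiltration P Q) (ScenarioTree.planMeasure P Q π) := by
  obtain ⟨π, hπ⟩ := ScenarioTree.exists_isOptimalPlan P Q d r hlam
  obtain ⟨m, M, hM, hG⟩ := hπ.exists_dual hlam
  have hm := (ScenarioTree.weak_duality hlam hM hπ.1).2.2 hG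
  have huniq : ∀ ρ, ScenarioTree.IsOptimalPlan P Q d r lam ρ → ρ = π := fun ρ hρ => by
    have hval := le_antisymm (hπ.2 ρ hρ.1) (hρ.2 π hπ.1)
    exact ((ScenarioTree.weak_duality hlam hM hρ.1).2.1 (by rw [hm, hval])).trans hG.symm
  have hopt : ScenarioTree.IsDualOptimal P Q d r lam m M := ⟨hM,
    fun n ⟨N, hN⟩ => hm ▸ (ScenarioTree.weak_duality hlam hN hπ.1).1, fun _ h => h ⟨M, hM⟩⟩
  refine ⟨⟨π, hπ, huniq⟩, ⟨m, M, hopt⟩, fun n N ρ hN hρ => ⟨fun x => ?_, hN.1.1.martingale hρ.1⟩⟩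
  obtain rfl := huniq ρ hρ
  have hnm : n = m := hN.2.unique hopt.2
  exact congrFun ((ScenarioTree.weak_duality hlam hN.1 hρ.1).2.1 (hnm ▸ hm)) x
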